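/- Let $p$ be an odd prime. Let $\mathcal Q(p)$ be the universal Steenrod algebra at $p$, that is, the unital associative $\mathbb F_p$-algebra generated by symbols $z_{\epsilon,k}$ ($\epsilon\in\{0,1\}$, $k\in\mathbb Z$) subject to the generalized Adem relations $R(\epsilon,k,n)=0$ and $S(\epsilon,k,n)=0$ for all $\epsilon\in\{0,1\}$, $k\in\mathbb Z$ and integers $n\ge 0$, where $$R(\epsilon,k,n)=z_{\epsilon,pk-1-n}z_{0,k}+\sum_{j\ge 0}(-1)^j\binom{(p-1)(n-j)-1}{j}z_{\epsilon,pk-1-j}z_{0,k-n+j},$$ $$S(\epsilon,k,n)=z_{\epsilon,pk-n}z_{1,k}+\sum_{j\ge 0}(-1)^{j}\binom{(p-1)(n-j)-1}{j}z_{\epsilon,pk-j}z_{1,k-n+j}+(1-\epsilon)\sum_{j\ge 0}(-1)^{j+1}\binom{(p-1)(n-j)}{j}z_{1,pk-j}z_{0,k-n+j},$$ and a binomial coefficient with negative upper entry is $0$. These relations are homogeneous of length $2$, so $\mathcal Q(p)$ is graded by length: its component of degree $m$ is the span of the monomials $z_{\epsilon_1,i_1}\cdots z_{\epsilon_m,i_m}$.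 For $\epsilon\in\{0,1\}$ let $\mathcal Q^\epsilon$ be the subalgebra of $\mathcal Q(p)$ generated by $1$ and all $z_{\epsilon,k}$, $k\in\mathbb Z$. For $s\ge 0$ let $\mathcal Q^0_s$ be the subalgebra generated by $1$ and all $z_{0,p^sm-\alpha_s}$, $m\in\mathbb Z$, where $\alpha_s=\frac{p^s-1}{p-1}$, and let $\mathcal Q^1_s$ be the subalgebra generated by $1$ and all $z_{1,p^sm}$, $m\in\mathbb Z$. **Theorem.** Let $\epsilon\in\{0,1\}$. Then $$\mathcal Q^\epsilon=\mathcal Q^\epsilon_0\supset\mathcal Q^\epsilon_1\supset\mathcal Q^\epsilon_2\supset\cdots$$ is a strictly descending chain of subalgebras of $\mathcal Q(p)$. Each $\mathcal Q^\epsilon_s$ is the direct sum of its intersections with the length components of $\mathcal Q(p)$, and is isomorphic to $\mathcal Q^\epsilon$ as a length-graded algebra. More precisely, there is an injective algebra endomorphism $\varphi$ of $\mathcal Q^\epsilon$ with $\varphi(z_{0,k})=z_{0,pk-1}$ for all $k\in\mathbb Z$ if $\epsilon=0$, and $\varphi(z_{1,k})=z_{1,pk}$ for all $k\in\mathbb Z$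 if $\epsilon=1$; moreover, for every $s\ge 0$ one has $\varphi^s(\mathcal Q^\epsilon)=\mathcal Q^\epsilon_s$, and $\varphi^s$ induces an isomorphism $\mathcal Q^\epsilon\to\mathcal Q^\epsilon_s$ of algebras that maps, for every $m\ge 0$, the elements of length degree $m$ of $\mathcal Q^\epsilon$ onto those of $\mathcal Q^\epsilon_s$. -/

import Mathlib

namespace SteenrodFractal

/-- The binomial coefficient with an integer upper entry, under the convention of the
Adem relations: it vanishes when the upper entry is negative. -/
def binom (a : ℤ) (j : ℕ) : ℕ := if 0 ≤ a then a.toNat.choose j else 0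

/-- The free unital associative `𝔽_p`-algebra on the symbols `z_{ε,k}`, `ε ∈ {0,1}`, `k ∈ ℤ`. -/
abbrev FreeSteenrod (p : ℕ) : Type := FreeAlgebra (ZMod p) (Fin 2 × ℤ)

/-- The free generator `z_{ε,k}`. -/
def freeZ (p : ℕ) (ε : Fin 2) (k : ℤ) : FreeSteenrod p := FreeAlgebra.ι (ZMod p) (ε, k)

/-- The quadratic polynomial `R(ε,k,n)`. The sum is over all `j ≥ 0`; the coefficients with
`j > n` (indeed those with `j ≥ n`) are zero. -/
def relR (p : ℕ) (ε : Fin 2) (k : ℤ) (n : ℕ) : FreeSteenrod p :=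
  freeZ p ε (p * k - 1 - n) * freeZ p 0 k +
    ∑ j ∈ Finset.range (n + 1),
      ((-1 : ZMod p) ^ j * (binom (((p : ℤ) - 1) * ((n : ℤ) - j) - 1) j : ZMod p)) •
        (freeZ p ε (p * k - 1 - j) * freeZ p 0 (k - n + j))

/-- The quadratic polynomial `S(ε,k,n)`. The sums are over all `j ≥ 0`; the coefficients with
`j > n` are zero. The last sum occurs only for `ε = 0`. The signs are those of the classical Adem
relations for `P^a β P^b`. -/
def relS (p : ℕ) (ε : Fin 2) (k : ℤ) (n : ℕ) : FreeSteenrod p :=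
  freeZ p ε (p * k - n) * freeZ p 1 k +
    ∑ j ∈ Finset.range (n + 1),
      ((-1 : ZMod p) ^ j * (binom (((p : ℤ) - 1) * ((n : ℤ) - j) - 1) j : ZMod p)) •
        (freeZ p ε (p * k - j) * freeZ p 1 (k - n + j)) +
    if ε = 0 then
      ∑ j ∈ Finset.range (n + 1),
        ((-1 : ZMod p) ^ (j + 1) * (binom (((p : ℤ) - 1) * ((n : ℤ) - j)) j : ZMod p)) •
          (freeZ p 1 (p * k - j) * freeZ p 0 (k - n + j))
    else 0

/-- The generalized Adem relations `R(ε,k,n) = 0` and `S(ε,k,n) = 0`. -/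
inductive AdemRel (p : ℕ) : FreeSteenrod p → FreeSteenrod p → Prop
  | R (ε : Fin 2) (k : ℤ) (n : ℕ) : AdemRel p (relR p ε k n) 0
  | S (ε : Fin 2) (k : ℤ) (n : ℕ) : AdemRel p (relS p ε k n) 0

/-- The universal Steenrod algebra `Q(p)` at an odd prime `p`: the quotient of the free algebra by
the two-sided ideal generated by the generalized Adem relations. -/
abbrev Q (p : ℕ) : Type := RingQuot (AdemRel p)

/-- The generator `z_{ε,k}` of `Q(p)`. -/
def z (p : ℕ) (ε : Fin 2) (k : ℤ) : Q p :=
  RingQuot.mkAlgHom (ZMod p) (AdemRel p) (freeZ p ε k)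

/-- The span in `Q(p)` of the monomials `z_{ε₁,i₁} ⋯ z_{ε_m,i_m}` of length `m`. -/
def lengthPart (p m : ℕ) : Submodule (ZMod p) (Q p) :=
  Submodule.span (ZMod p)
    {x | ∃ I : List (Fin 2 × ℤ), I.length = m ∧ x = (I.map fun i => z p i.1 i.2).prod}

/-- The elements of length degree `m` of a subalgebra of `Q(p)`. -/
def subLengthPart {p : ℕ} (A : Subalgebra (ZMod p) (Q p)) (m : ℕ) : Submodule (ZMod p) A :=
  (lengthPart p m).comap A.val.toLinearMap

/-- The subalgebra `Q^ε` of `Q(p)` generated by `1` and all `z_{ε,k}`, `k ∈ ℤ`. -/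
def Qeps (p : ℕ) (ε : Fin 2) : Subalgebra (ZMod p) (Q p) :=
  Algebra.adjoin (ZMod p) (Set.range (z p ε))

theorem z_mem_Qeps (p : ℕ) (ε : Fin 2) (k : ℤ) : z p ε k ∈ Qeps p ε :=
  Algebra.subset_adjoin ⟨k, rfl⟩

/-- The generator `z_{ε,k}` as an element of `Q^ε`. -/
def zeps (p : ℕ) (ε : Fin 2) (k : ℤ) : Qeps p ε := ⟨z p ε k, z_mem_Qeps p ε k⟩

/-- The map `k ↦ pk - 1` for `ε = 0`, and `k ↦ pk` for `ε = 1`. -/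
def shift (p : ℕ) (ε : Fin 2) (k : ℤ) : ℤ := if ε = 0 then p * k - 1 else p * k

/-- The subalgebra `Q^ε_s`, generated by `1` and the elements `z_{0,p^s m - α_s}`, `m ∈ ℤ`, where
`α_s = 1 + p + ⋯ + p^(s-1) = (p^s - 1)/(p - 1)`, if `ε = 0`, and by `1` and the elements
`z_{1,p^s m}`, `m ∈ ℤ`, if `ε = 1`. -/
def Qchain (p : ℕ) (ε : Fin 2) (s : ℕ) : Subalgebra (ZMod p) (Q p) :=
  Algebra.adjoin (ZMod p) (Set.range fun m : ℤ =>
    z p ε ((p : ℤ) ^ s * m - if ε = 0 then ∑ i ∈ Finset.range s, (p : ℤ) ^ i else 0))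

end SteenrodFractal

/-!
The relations of `Q(p)` in which both kinds of generators occur have both kinds in each of their
monomials; hence any family satisfying the Adem relations among the `z_{ε,k}` extends to a
homomorphism out of `Q(p)` that kills the generators of the other kind (`liftQ`). By Lucas'
theorem the rescaling `k ↦ pk - δ`, with `δ = 1` for `ε = 0` and `δ = 0` for
`ε = 1`, maps the relation `(k, n)` to the relation `(pk - δ, pn)`, all other terms of the latter
being zero modulo `p` (`ademSum_rescale`). So there is an endomorphism `frob` of `Q(p)` with
`z_{ε,k} ↦ z_{ε,pk-δ}`, and `Q^ε_s` is the image of `Q^ε` under its `s`-th power.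

Injectivity of `frob` on `Q^ε` follows from a basis: `frob` maps the set of admissible monomials
`z_{ε,i₁} ⋯ z_{ε,i_m}`, those with `i_t > p i_{t+1} - δ`, injectively to itself. They span
`Q^ε` (`Qeps_le_span_admissible`): although the indices are arbitrary integers, the Adem relations
preserve certain upper bounds on the indices, and the weighted distance to these bounds drops in
each rewriting. They are linearly independent (`linearIndependent_admissible`) because `Q^ε` acts by
reduced powers. The relations among the `z_{ε,k}` are stable under adding `pc` to the first and `c`
to the second index, and under the sum of the two translations by `-1` (`ademCoeff_pascal`), hence
by Frobenius under the sum of the two translations by `-q` for each power `q` of `p`. By the Cartan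
formula, this is what is needed for the reduced powers on products of monomials `x^(p^a)` to satisfy
the Adem relations (`reducedPower_mem_ademAnnihilator`). Twisting the action by translations, which
depend on the position in a monomial, makes all indices of a given admissible monomial nonnegative
and also accounts for `δ`. Finally, for each admissible monomial there is a coefficient of the
result that receives no contribution from the lexicographically larger ones.

The chain descends strictly since a homomorphism to the dual numbers detects a single generator, and
the length components are separated by the homomorphism `Q(p) → Q(p)[X]` with `z ↦ z X`.
-/

namespace SteenrodFractal

open Finset

variable {p : ℕ} [hp : Fact p.Prime]

/-! ### The coefficients of the Adem relations -/

/-- The coefficient with which `z_{pk-δ-j} z_{k-n+j}` enters the `n`-th Adem relation: the signed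
binomial coefficient, plus `1` at `j = n`, where the leading monomial of the relation sits. -/
def ademCoeff (p n j : ℕ) : ZMod p :=
  (-1) ^ j * (binom (((p : ℤ) - 1) * ((n : ℤ) - j) - 1) j : ZMod p) + if j = n then 1 else 0

theorem binom_natCast (a j : ℕ) : binom (a : ℤ) j = a.choose j := by
  simp [binom]

theorem binom_of_neg {a : ℤ} (h : a < 0) (j : ℕ) : binom a j = 0 := by
  simp [binom, not_le.2 h]

theorem binom_diag (p n : ℕ) : binom (((p : ℤ) - 1) * ((n : ℤ) - n) - 1) n = 0 :=
  binom_of_neg (by simp) n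

theorem ademCoeff_self (n : ℕ) : ademCoeff p n n = 1 := by
  rw [ademCoeff, binom_diag, Nat.cast_zero, mul_zero, zero_add, if_pos rfl]

theorem ademCoeff_of_lt {n j : ℕ} (h : n < j) : ademCoeff p n j = 0 := by
  have hp1 : (1 : ℤ) ≤ p := by exact_mod_cast hp.out.one_le
  have : ((p : ℤ) - 1) * ((n : ℤ) - j) - 1 < 0 := by
    have : ((p : ℤ) - 1) * ((n : ℤ) - j) ≤ 0 :=
      mul_nonpos_of_nonneg_of_nonpos (by omega) (by omega)
    omega
  simp [ademCoeff, binom_of_neg this, h.ne']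

theorem ademCoeff_add_right (j d : ℕ) :
    ademCoeff p (j + (d + 1)) j = (-1) ^ j * (((p - 1) * (d + 1) - 1).choose j : ZMod p) := by
  have h1 : 1 ≤ (p - 1) * (d + 1) := Nat.mul_pos (Nat.sub_pos_of_lt hp.out.one_lt) d.succ_pos
  have : ((p : ℤ) - 1) * (((j + (d + 1) : ℕ) : ℤ) - j) - 1 = ((p - 1) * (d + 1) - 1 : ℕ) := by
    push_cast [Nat.cast_sub h1, Nat.cast_sub hp.out.one_le]
    ring
  rw [ademCoeff, this, binom_natCast, if_neg (by omega), add_zero]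

theorem ademCoeff_zero_right (n : ℕ) : ademCoeff p n 0 = 1 := by
  cases n with
  | zero => exact ademCoeff_self 0
  | succ d => simpa using ademCoeff_add_right (p := p) 0 d

theorem neg_one_pow_prime : (-1 : ZMod p) ^ p = -1 := by
  rw [ZMod.pow_card]

/-- Multiplying by `(1 + X) ^ p = 1 + X ^ p` modulo `p`. -/
theorem choose_add_prime (N j : ℕ) :
    ((N + p).choose j : ZMod p) = N.choose j + if p ≤ j then (N.choose (j - p) : ZMod p) else 0 := by
  have h : ((1 + Polynomial.X : Polynomial (ZMod p)) ^ (N + p)) =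
      (1 + Polynomial.X) ^ N + (1 + Polynomial.X) ^ N * Polynomial.X ^ p := by
    rw [pow_add, add_pow_char (p := p), one_pow, mul_add, mul_one]
  have := congrArg (Polynomial.coeff · j) h
  simpa [Polynomial.coeff_one_add_X_pow, Polynomial.coeff_mul_X_pow'] using this

theorem choose_prime_sub_one (n : ℕ) :
    ((p - 1).choose n : ZMod p) = if n < p then (-1) ^ n else 0 := by
  split_ifs with h
  · induction n with
    | zero => simp
    | succ n ih =>
      have h1 := Nat.choose_succ_succ (p - 1) n
      have h2 : ((p.choose (n + 1) : ℕ) : ZMod p) = 0 :=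
        (ZMod.natCast_eq_zero_iff _ _).2 (hp.out.dvd_choose_self (by omega) h)
      rw [Nat.succ_eq_add_one, Nat.sub_add_cancel hp.out.one_le] at h1
      rw [Nat.succ_eq_add_one] at h1
      rw [h1, Nat.cast_add, ih (by omega)] at h2
      rw [pow_succ]
      linear_combination h2
  · have := hp.out.pos
    rw [Nat.choose_eq_zero_of_lt (by omega), Nat.cast_zero]

/-- The recursion among the Adem coefficients that makes the relations compatible with the Cartan
formula. -/
theorem ademCoeff_pascal (n j : ℕ) :
    ademCoeff p n (j + 1) + ademCoeff p n j = ademCoeff p (n + 1) (j + 1) +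
      if p ≤ j + 1 ∧ p ≤ n then ademCoeff p (n - p) (j + 1 - p) else 0 := by
  have hp2 := hp.out.two_le
  rcases lt_trichotomy n (j + 1) with h | rfl | h
  · rw [ademCoeff_of_lt h]
    have h4 : ¬ (p ≤ j + 1 ∧ p ≤ n) ∨ ademCoeff p (n - p) (j + 1 - p) = 0 := by
      by_cases h' : p ≤ j + 1 ∧ p ≤ n
      · exact Or.inr (ademCoeff_of_lt (by omega))
      · exact Or.inl h'
    have h5 : (if p ≤ j + 1 ∧ p ≤ n then ademCoeff p (n - p) (j + 1 - p) else 0) = 0 := by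
      rcases h4 with h' | h'
      · rw [if_neg h']
      · rw [h', ite_self]
    rw [h5]
    rcases (Nat.lt_succ_iff.1 h).eq_or_lt with rfl | h
    · rw [ademCoeff_self, ademCoeff_self, zero_add, add_zero]
    · rw [ademCoeff_of_lt h, ademCoeff_of_lt (by omega)]
  · have h1 := ademCoeff_add_right (p := p) j 0
    have h2 := ademCoeff_add_right (p := p) (j + 1) 0
    simp only [zero_add, mul_one] at h1 h2
    rw [ademCoeff_self, ademCoeff_self, h1, h2]
    have h3 := choose_prime_sub_one (p := p) (j + 1)
    have h4 := Nat.choose_succ_succ (p - 1 - 1) j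
    simp only [Nat.succ_eq_add_one, Nat.sub_add_cancel (show 1 ≤ p - 1 by omega)] at h4
    rw [h4, Nat.cast_add] at h3
    have h5 : ((-1 : ZMod p) ^ (j + 1)) * (-1) ^ (j + 1) = 1 := by
      rw [← mul_pow]; simp
    by_cases hj : j + 1 < p
    · rw [if_neg (by omega)]
      rw [if_pos hj] at h3
      linear_combination (-1) ^ j * h3 - h5
    · rw [if_pos (by omega)]
      rw [if_neg hj] at h3
      linear_combination (-1) ^ j * h3
  · obtain ⟨d, rfl⟩ := Nat.exists_eq_add_of_lt h
    have h1 := ademCoeff_add_right (p := p) (j + 1) d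
    have h2 := ademCoeff_add_right (p := p) j (d + 1)
    have h3 := ademCoeff_add_right (p := p) (j + 1) (d + 1)
    rw [show j + (d + 1 + 1) = j + 1 + d + 1 by ring] at h2
    rw [show j + 1 + (d + 1 + 1) = j + 1 + d + 1 + 1 by ring] at h3
    rw [← add_assoc] at h1
    obtain ⟨N, hN⟩ : ∃ N, (p - 1) * (d + 1) = N + 1 :=
      ⟨_, (Nat.sub_add_cancel (Nat.mul_pos (by omega) d.succ_pos)).symm⟩
    have hM : (p - 1) * (d + 1 + 1) - 1 = N + (p - 1) := by
      rw [mul_add, hN, mul_one]; omega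
    rw [hM] at h2 h3
    rw [hN, Nat.add_sub_cancel] at h1
    have hP := Nat.choose_succ_succ (N + (p - 1)) j
    have hQ := choose_add_prime (p := p) N (j + 1)
    simp only [Nat.succ_eq_add_one, add_assoc, Nat.sub_add_cancel hp.out.one_le] at hP
    rw [hP, Nat.cast_add] at hQ
    rw [h1, h2, h3]
    by_cases hj : p ≤ j + 1
    · rw [if_pos hj] at hQ
      rw [if_pos (by omega)]
      have h4 := ademCoeff_add_right (p := p) (j + 1 - p) d
      rw [show j + 1 - p + (d + 1) = j + 1 + d + 1 - p by omega, hN, Nat.add_sub_cancel] at h4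
      rw [h4]
      have h5 : (-1 : ZMod p) ^ (j + 1) = - (-1) ^ (j + 1 - p) := by
        conv_lhs => rw [← Nat.sub_add_cancel hj, pow_add, neg_one_pow_prime]
        ring
      linear_combination (-1) ^ j * hQ - ((N.choose (j + 1 - p) : ℕ) : ZMod p) * h5
    · rw [if_neg hj] at hQ
      rw [if_neg (by omega)]
      linear_combination (-1) ^ j * hQ

/-- Lucas' theorem for the Adem coefficients, at multiples of `p`. -/
theorem ademCoeff_mul (n j : ℕ) : ademCoeff p (p * n) (p * j) = ademCoeff p n j := by
  have hp2 := hp.out.two_le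
  rcases lt_trichotomy n j with h | rfl | h
  · rw [ademCoeff_of_lt h, ademCoeff_of_lt ((Nat.mul_lt_mul_left hp.out.pos).2 h)]
  · rw [ademCoeff_self, ademCoeff_self]
  · obtain ⟨d, rfl⟩ := Nat.exists_eq_add_of_lt h
    have h0 : p * (d + 1) - 1 + 1 = p * (d + 1) :=
      Nat.sub_add_cancel (Nat.mul_pos hp.out.pos d.succ_pos)
    have h1 := ademCoeff_add_right (p := p) (p * j) (p * (d + 1) - 1)
    rw [h0, ← mul_add, ← add_assoc] at h1
    have h2 := ademCoeff_add_right (p := p) j d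
    rw [← add_assoc] at h2
    rw [h1, h2, pow_mul, neg_one_pow_prime]
    congr 1
    obtain ⟨N, hN⟩ : ∃ N, (p - 1) * (d + 1) = N + 1 :=
      ⟨_, (Nat.sub_add_cancel (Nat.mul_pos (by omega) d.succ_pos)).symm⟩
    have h3 : (p - 1) * (p * (d + 1)) - 1 = (p - 1) + p * N := by
      rw [mul_left_comm, hN, mul_add, mul_one]; omega
    rw [h3, hN, Nat.add_sub_cancel]
    have := (ZMod.natCast_eq_natCast_iff _ _ _).2
      (Choose.choose_modEq_choose_mod_mul_choose_div_nat (p := p) (n := p - 1 + p * N) (k := p * j))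
    rw [this, Nat.add_mul_mod_self_left, Nat.mul_mod_right, Nat.choose_zero_right,
      Nat.mul_div_cancel_left _ hp.out.pos, Nat.add_mul_div_left _ _ hp.out.pos,
      Nat.div_eq_of_lt (by omega), zero_add, one_mul]

/-- Lucas' theorem for the Adem coefficients, away from the multiples of `p`. -/
theorem ademCoeff_mul_of_not_dvd (n : ℕ) {i : ℕ} (hi : ¬ p ∣ i) : ademCoeff p (p * n) i = 0 := by
  have hp2 := hp.out.two_le
  rcases lt_trichotomy (p * n) i with h | h | h
  · exact ademCoeff_of_lt h
  · exact absurd ⟨n, h.symm⟩ hi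
  · obtain ⟨d, hd⟩ := Nat.exists_eq_add_of_lt h
    have h1 := ademCoeff_add_right (p := p) i d
    rw [← add_assoc, ← hd] at h1
    rw [h1]
    convert mul_zero _
    have := (ZMod.natCast_eq_natCast_iff _ _ _).2
      (Choose.choose_modEq_choose_mod_mul_choose_div_nat (p := p)
        (n := (p - 1) * (d + 1) - 1) (k := i))
    rw [this, Nat.choose_eq_zero_of_lt, zero_mul, Nat.cast_zero]
    -- the upper entry is congruent to `i - 1`
    have hr : 0 < i % p := Nat.pos_of_ne_zero fun h0 => hi (Nat.dvd_of_mod_eq_zero h0)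
    have hrp : i % p < p := Nat.mod_lt _ hp.out.pos
    have hi' := Nat.mod_add_div i p
    obtain ⟨N, hN⟩ : ∃ N, (p - 1) * (d + 1) = N + 1 :=
      ⟨_, (Nat.sub_add_cancel (Nat.mul_pos (by omega) d.succ_pos)).symm⟩
    have h2 : N ≡ i % p - 1 [MOD p] := by
      have h3 : N + 1 + (d + 1) = p * (d + 1) := by
        rw [← hN, ← Nat.succ_mul, Nat.succ_eq_add_one, Nat.sub_add_cancel hp.out.one_le]
      rw [← Int.natCast_modEq_iff, Int.modEq_iff_dvd]
      refine ⟨(n : ℤ) - i / p - (d + 1), ?_⟩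
      zify [hr] at hi' hd h3 ⊢
      linarith
    rw [hN, Nat.add_sub_cancel, h2, Nat.mod_eq_of_lt (by omega)]
    omega

/-! ### The Adem relations as linear conditions -/

/-- The value of the `n`-th Adem relation with second index `k` on a family `f i k`, thought of as
the values on the monomials `z_i z_k`. The parameter `δ` is `1` for the relations among the
`z_{0,k}` and `0` for those among the `z_{1,k}`. -/
def ademSum {M : Type*} [AddCommGroup M] [Module (ZMod p) M] (δ : ℤ) (f : ℤ → ℤ → M) (k : ℤ)
    (n : ℕ) : M :=
  ∑ j ∈ range (n + 1), ademCoeff p n j • f (p * k - δ - j) (k - n + j)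

section

variable {M : Type*} [AddCommGroup M] [Module (ZMod p) M] {δ : ℤ}

theorem ademSum_eq_add (f : ℤ → ℤ → M) (k : ℤ) (n : ℕ) :
    ademSum (p := p) δ f k n = f (p * k - δ - n) k + ∑ j ∈ range (n + 1),
      ((-1 : ZMod p) ^ j * (binom (((p : ℤ) - 1) * ((n : ℤ) - j) - 1) j : ZMod p)) •
        f (p * k - δ - j) (k - n + j) := by
  simp only [ademSum, ademCoeff, add_smul, sum_add_distrib, ite_smul, one_smul, zero_smul]
  rw [add_comm, sum_ite_eq' (range (n + 1)) n, if_pos (self_mem_range_succ n), sub_add_cancel]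

theorem ademSum_eq_sum_add (f : ℤ → ℤ → M) (k : ℤ) (n : ℕ) :
    ademSum (p := p) δ f k n =
      ∑ j ∈ range n, ademCoeff p n j • f (p * k - δ - j) (k - n + j) + f (p * k - δ - n) k := by
  rw [ademSum, sum_range_succ, ademCoeff_self, one_smul, sub_add_cancel]

theorem ademSum_add (f g : ℤ → ℤ → M) (k : ℤ) (n : ℕ) :
    ademSum (p := p) δ (f + g) k n = ademSum (p := p) δ f k n + ademSum (p := p) δ g k n := by
  simp [ademSum, sum_add_distrib]

theorem map_ademSum {N : Type*} [AddCommGroup N] [Module (ZMod p) N] (L : M →ₗ[ZMod p] N)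
    (f : ℤ → ℤ → M) (k : ℤ) (n : ℕ) :
    L (ademSum (p := p) δ f k n) = ademSum (p := p) δ (fun i k => L (f i k)) k n := by
  simp [ademSum]

/-- The Frobenius self-similarity of the Adem relations: rescaling the indices by
`k ↦ pk - δ` turns the relation `(k, n)` into the relation `(pk - δ, pn)`. -/
theorem ademSum_rescale (f : ℤ → ℤ → M) (k : ℤ) (n : ℕ) :
    ademSum (p := p) δ (fun i k => f (p * i - δ) (p * k - δ)) k n =
      ademSum (p := p) δ f (p * k - δ) (p * n) := by
  refine sum_of_injOn (p * ·) ?_ ?_ ?_ ?_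
  · exact fun a _ b _ h => Nat.eq_of_mul_eq_mul_left hp.out.pos h
  · intro j hj
    simp only [coe_range, Set.mem_Iio] at hj ⊢
    exact Nat.lt_succ_of_le (Nat.mul_le_mul_left p (Nat.le_of_lt_succ hj))
  · intro i hi hi'
    rw [ademCoeff_mul_of_not_dvd, zero_smul]
    rintro ⟨j, rfl⟩
    refine hi' ⟨j, ?_, rfl⟩
    simp only [coe_range, Set.mem_Iio, mem_range] at hi ⊢
    exact Nat.lt_succ_of_le (Nat.le_of_mul_le_mul_left (Nat.le_of_lt_succ hi) hp.out.pos)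
  · intro j _
    dsimp only
    rw [ademCoeff_mul]
    refine congrArg (_ • ·) (congrArg₂ f ?_ ?_) <;> (push_cast; ring)

/-- Reindexing by `k ↦ k + c` in the second factor and `i ↦ i + pc - 1 + δ` in the first one
carries the relations with parameter `δ` to those with parameter `1`. -/
theorem ademSum_translate (f : ℤ → ℤ → M) (c k : ℤ) (n : ℕ) :
    ademSum (p := p) δ (fun i k => f (i + (p * c - 1 + δ)) (k + c)) k n =
      ademSum (p := p) 1 f (k + c) n := by
  refine sum_congr rfl fun j _ => congrArg (_ • ·) (congrArg₂ f ?_ ?_) <;> ring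

end

/-! ### Families annihilated by the Adem relations -/

section

variable (p) in
/-- The families `f i k` on which all Adem relations (with parameter `δ = 1`) vanish. -/
def ademAnnihilator : Submodule (ZMod p) (ℤ → ℤ → ZMod p) where
  carrier := {f | ∀ k n, ademSum (p := p) 1 f k n = 0}
  add_mem' hf hg k n := by rw [ademSum_add, hf, hg, add_zero]
  zero_mem' k n := by simp [ademSum]
  smul_mem' c f hf k n := by
    have := map_ademSum (p := p) (δ := 1) (LinearMap.lsmul (ZMod p) (ZMod p) c) f k n
    rw [hf, map_zero] at this
    exact this.symm

/-- The translation of a family by `-1` in the first index. -/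
def shiftLeft (p : ℕ) : Module.End (ZMod p) (ℤ → ℤ → ZMod p) where
  toFun f i k := f (i - 1) k
  map_add' _ _ := rfl
  map_smul' _ _ := rfl

/-- The translation of a family by `-1` in the second index. -/
def shiftRight (p : ℕ) : Module.End (ZMod p) (ℤ → ℤ → ZMod p) where
  toFun f i k := f i (k - 1)
  map_add' _ _ := rfl
  map_smul' _ _ := rfl

theorem shiftLeft_pow {p : ℕ} (q : ℕ) (f : ℤ → ℤ → ZMod p) (i k : ℤ) :
    (shiftLeft p ^ q) f i k = f (i - q) k := by
  induction q generalizing i with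
  | zero => simp
  | succ q ih =>
    rw [pow_succ', Module.End.mul_apply]
    refine (ih (i - 1)).trans ?_
    congr 1; push_cast; ring

theorem shiftRight_pow {p : ℕ} (q : ℕ) (f : ℤ → ℤ → ZMod p) (i k : ℤ) :
    (shiftRight p ^ q) f i k = f i (k - q) := by
  induction q generalizing k with
  | zero => simp
  | succ q ih =>
    rw [pow_succ', Module.End.mul_apply]
    refine (ih (k - 1)).trans ?_
    congr 1; push_cast; ring

theorem commute_shift (p : ℕ) : Commute (shiftLeft p) (shiftRight p) := rfl

/-- Splitting a sum over consecutive pairs according to the recursion `ademCoeff_pascal`. -/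
theorem sum_ademCoeff_pascal {M : Type*} [AddCommGroup M] [Module (ZMod p) M] (e : ℕ → M) (n : ℕ) :
    ∑ j ∈ range (n + 1), ademCoeff p n j • (e (j + 1) + e j) =
      ∑ j ∈ range (n + 2), ademCoeff p (n + 1) j • e j +
        if p ≤ n then ∑ j ∈ range (n - p + 1), ademCoeff p (n - p) j • e (p + j) else 0 := by
  have h1 : ∑ j ∈ range (n + 1), ademCoeff p n j • e j =
      ∑ j ∈ range (n + 1), ademCoeff p n (j + 1) • e (j + 1) + e 0 := by
    have := sum_range_succ' (fun j => ademCoeff p n j • e j) (n + 1)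
    rw [sum_range_succ, ademCoeff_of_lt n.lt_succ_self, zero_smul, add_zero, ademCoeff_zero_right,
      one_smul] at this
    exact this
  have h2 : ∑ j ∈ range (n + 1), (if p ≤ j + 1 ∧ p ≤ n then ademCoeff p (n - p) (j + 1 - p) else 0) •
      e (j + 1) =
        if p ≤ n then ∑ j ∈ range (n - p + 1), ademCoeff p (n - p) j • e (p + j) else 0 := by
    split_ifs with hn
    · have h3 := sum_range_succ' (fun j => (if p ≤ j then ademCoeff p (n - p) (j - p) else 0) • e j)
        (n + 1)
      rw [if_neg (by simpa using hp.out.ne_zero), zero_smul, add_zero] at h3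
      simp only [hn, and_true]
      rw [← h3, show n + 1 + 1 = p + (n - p + 2) by omega, sum_range_add,
        sum_eq_zero fun j hj => by rw [if_neg (not_le.2 (mem_range.1 hj)), zero_smul], zero_add,
        sum_range_succ, Nat.add_sub_cancel_left, ademCoeff_of_lt (Nat.lt_succ_self _), ite_self,
        zero_smul, add_zero]
      simp
    · simp [hn]
  simp only [smul_add, sum_add_distrib]
  rw [h1, sum_range_succ' _ (n + 1), ademCoeff_zero_right, one_smul, ← h2, ← add_assoc,
    ← sum_add_distrib, add_right_comm, ← sum_add_distrib]
  congr 1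
  refine sum_congr rfl fun j _ => ?_
  rw [← add_smul, ← add_smul, ← ademCoeff_pascal, add_comm]

theorem shiftLeft_add_shiftRight_mem {f : ℤ → ℤ → ZMod p} (hf : f ∈ ademAnnihilator p) :
    (shiftLeft p + shiftRight p) f ∈ ademAnnihilator p := by
  intro k n
  have h := sum_ademCoeff_pascal (p := p)
    (fun j => f (p * k - 1 - j) (k - (n + 1 : ℕ) + j)) n
  have h1 := hf k (n + 1)
  have h2 : (if p ≤ n then ∑ j ∈ range (n - p + 1), ademCoeff p (n - p) j •
      f (p * k - 1 - (p + j : ℕ)) (k - (n + 1 : ℕ) + (p + j : ℕ)) else 0) = 0 := by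
    split_ifs with hn
    · rw [← hf (k - 1) (n - p)]
      refine sum_congr rfl fun j _ => congrArg (_ • ·) (congrArg₂ f ?_ ?_) <;>
        (push_cast [Nat.cast_sub hn]; ring)
    · rfl
  rw [ademSum] at h1
  rw [h2, h1, add_zero] at h
  rw [← h]
  refine sum_congr rfl fun j _ => ?_
  refine congrArg (_ • ·) (congrArg₂ (fun a b : ZMod p => a + b) ?_ ?_)
  · refine congrArg₂ f ?_ ?_ <;> (push_cast; ring)
  · refine congrArg₂ f ?_ ?_ <;> (push_cast; ring)

theorem shift_pow_add_shift_pow_mem {f : ℤ → ℤ → ZMod p} (hf : f ∈ ademAnnihilator p) (e : ℕ) :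
    (shiftLeft p ^ p ^ e + shiftRight p ^ p ^ e) f ∈ ademAnnihilator p := by
  have h1 : ∀ m : ℕ, ((shiftLeft p + shiftRight p) ^ m) f ∈ ademAnnihilator p := by
    intro m
    induction m with
    | zero => exact hf
    | succ m ih =>
      rw [pow_succ', Module.End.mul_apply]
      exact shiftLeft_add_shiftRight_mem ih
  have h2 : (shiftLeft p + shiftRight p) ^ p ^ e = shiftLeft p ^ p ^ e + shiftRight p ^ p ^ e := by
    have : CharP (Module.End (ZMod p) (ℤ → ℤ → ZMod p)) p :=
      charP_of_injective_algebraMap (algebraMap (ZMod p) _).injective p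
    exact add_pow_char_pow_of_commute _ _ (commute_shift p)
  rw [← h2]
  exact h1 _

theorem translate_mem {f : ℤ → ℤ → ZMod p} (hf : f ∈ ademAnnihilator p) (c : ℤ) :
    (fun i k => f (i - p * c) (k - c)) ∈ ademAnnihilator p := by
  intro k n
  rw [← hf (k - c) n]
  refine sum_congr rfl fun j _ => congrArg (_ • ·) (congrArg₂ f ?_ ?_) <;> ring

end

/-! ### Reduced powers on the products of `p`-power monomials -/

/-- The reduced power `P^k`, with `P^k = 0` for `k < 0`, on the span of the monomials
`x₁^(p^a₁) ⋯ x_N^(p^a_N)` in `N` variables of degree two, in terms of coefficients: `y [a₁, …, a_N]`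
is the coefficient of that monomial. The recursion is the Cartan formula, since `x^(p^b)` has total
reduced power `x^(p^b) + x^(p^(b+1))`, the second term coming from `P^(p^b)`. -/
def reducedPower (p : ℕ) : ℤ → (List ℕ → ZMod p) → List ℕ → ZMod p
  | k, y, [] => if k = 0 then y [] else 0
  | k, y, 0 :: r => reducedPower p k (fun r => y (0 :: r)) r
  | k, y, (b + 1) :: r => reducedPower p k (fun r => y ((b + 1) :: r)) r +
      reducedPower p (k - p ^ b) (fun r => y (b :: r)) r

theorem reducedPower_add {p : ℕ} (k : ℤ) (y y' : List ℕ → ZMod p) :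
    reducedPower p k (y + y') = reducedPower p k y + reducedPower p k y' := by
  funext r
  induction r generalizing k y y' with
  | nil => simp only [reducedPower, Pi.add_apply]; split_ifs <;> simp
  | cons a r ih =>
    cases a with
    | zero => exact ih k (fun r => y (0 :: r)) (fun r => y' (0 :: r))
    | succ b =>
      refine (congrArg₂ (· + ·) (ih k (fun r => y ((b + 1) :: r)) (fun r => y' ((b + 1) :: r)))
        (ih (k - p ^ b) (fun r => y (b :: r)) (fun r => y' (b :: r)))).trans ?_
      exact add_add_add_comm _ _ _ _

theorem reducedPower_smul {p : ℕ} (k : ℤ) (c : ZMod p) (y : List ℕ → ZMod p) :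
    reducedPower p k (c • y) = c • reducedPower p k y := by
  funext r
  induction r generalizing k y with
  | nil => simp only [reducedPower, Pi.smul_apply]; split_ifs <;> simp
  | cons a r ih =>
    cases a with
    | zero => exact ih k (fun r => y (0 :: r))
    | succ b =>
      refine (congrArg₂ (· + ·) (ih k (fun r => y ((b + 1) :: r)))
        (ih (k - p ^ b) (fun r => y (b :: r)))).trans ?_
      exact (smul_add c _ _).symm

/-- The reduced powers satisfy the Adem relations, also those involving negative indices. -/
theorem reducedPower_mem_ademAnnihilator (y : List ℕ → ZMod p) (r : List ℕ) :
    (fun i k => reducedPower p i (reducedPower p k y) r) ∈ ademAnnihilator p := by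
  induction r generalizing y with
  | nil =>
    intro k n
    refine sum_eq_zero fun j hj => ?_
    simp only [reducedPower]
    split_ifs with h1 h2
    · have hp1 : (1 : ℤ) ≤ p := by exact_mod_cast hp.out.one_le
      have hjn : j ≤ n := Nat.le_of_lt_succ (mem_range.1 hj)
      obtain ⟨d, rfl⟩ : ∃ d, n = j + (d + 1) := by
        refine ⟨n - j - 1, ?_⟩
        have : n ≠ j := by
          rintro rfl
          have : k = 0 := by omega
          subst this
          omega
        omega
      obtain rfl : k = d + 1 := by push_cast at h2; omega
      -- here `j = pk - 1` exceeds the upper entry `(p - 1)k - 1` of the binomial coefficient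
      have h3 : p * (d + 1) = j + 1 := by zify; linarith
      rw [ademCoeff_add_right, Nat.choose_eq_zero_of_lt, Nat.cast_zero, mul_zero, zero_smul]
      have h4 : 2 * (d + 1) ≤ p * (d + 1) := Nat.mul_le_mul_right _ hp.out.two_le
      rw [Nat.sub_mul]
      omega
    · simp
    · simp
  | cons a r ih =>
    cases a with
    | zero => exact ih (fun r => y (0 :: r))
    | succ b =>
      cases b with
      | zero =>
        convert (ademAnnihilator p).add_mem (ih fun r => y (1 :: r))
          (shift_pow_add_shift_pow_mem (ih fun r => y (0 :: r)) 0) using 1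
        funext i k
        have h : (fun r => reducedPower p k y (1 :: r)) =
          reducedPower p k (fun r => y (1 :: r)) +
            reducedPower p (k - p ^ 0) (fun r => y (0 :: r)) := rfl
        have h' : reducedPower p i (reducedPower p k y) ((0 + 1) :: r) =
          reducedPower p i (fun r => reducedPower p k y (1 :: r)) r +
            reducedPower p (i - p ^ 0) (reducedPower p k (fun r => y (0 :: r))) r := rfl
        rw [h', h, reducedPower_add]
        simp only [Pi.add_apply, LinearMap.add_apply, shiftLeft_pow, shiftRight_pow, Nat.cast_pow]
        ring
      | succ b =>
        convert (ademAnnihilator p).add_mem ((ademAnnihilator p).add_mem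
          (ih fun r => y ((b + 2) :: r))
          (shift_pow_add_shift_pow_mem (ih fun r => y ((b + 1) :: r)) (b + 1)))
          (translate_mem (ih fun r => y (b :: r)) (p ^ b)) using 1
        funext i k
        have h : (fun r => reducedPower p k y ((b + 2) :: r)) =
          reducedPower p k (fun r => y ((b + 2) :: r)) +
            reducedPower p (k - p ^ (b + 1)) (fun r => y ((b + 1) :: r)) := rfl
        have h1 : (fun r => reducedPower p k y ((b + 1) :: r)) =
          reducedPower p k (fun r => y ((b + 1) :: r)) +
            reducedPower p (k - p ^ b) (fun r => y (b :: r)) := rfl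
        have h' : reducedPower p i (reducedPower p k y) ((b + 1 + 1) :: r) =
          reducedPower p i (fun r => reducedPower p k y ((b + 2) :: r)) r +
            reducedPower p (i - p ^ (b + 1)) (fun r => reducedPower p k y ((b + 1) :: r)) r := rfl
        rw [h', h, h1, reducedPower_add, reducedPower_add]
        simp only [Pi.add_apply, LinearMap.add_apply, shiftLeft_pow, shiftRight_pow, Nat.cast_pow,
          ← pow_succ']
        ring

/-- The largest `k` for which `P^k` can produce the monomial with exponents `r`: all variables
that occur with exponent larger than `1` come from their `p`-th root. -/
def topDegree (p : ℕ) (r : List ℕ) : ℤ := (r.map fun a => if a = 0 then 0 else (p : ℤ) ^ (a - 1)).sum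

theorem reducedPower_of_topDegree_lt {p : ℕ} {k : ℤ} (y : List ℕ → ZMod p) {r : List ℕ}
    (h : topDegree p r < k) : reducedPower p k y r = 0 := by
  induction r generalizing k y with
  | nil => exact if_neg (by simpa [topDegree] using h.ne')
  | cons a r ih =>
    cases a with
    | zero => exact ih _ (by simpa [topDegree] using h)
    | succ b =>
      simp only [topDegree, List.map_cons, List.sum_cons, Nat.succ_ne_zero, if_false,
        Nat.add_sub_cancel] at h
      have hb : (0 : ℤ) ≤ (p : ℤ) ^ b := by positivity
      rw [reducedPower, ih _ (by rw [topDegree]; linarith), ih _ (by rw [topDegree]; linarith),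
        add_zero]

theorem reducedPower_topDegree (y : List ℕ → ZMod p) (r : List ℕ) :
    reducedPower p (topDegree p r) y r = y (r.map Nat.pred) := by
  induction r generalizing y with
  | nil => exact if_pos rfl
  | cons a r ih =>
    cases a with
    | zero =>
      have : topDegree p (0 :: r) = topDegree p r := by simp [topDegree]
      rw [this]
      exact ih _
    | succ b =>
      have h : topDegree p ((b + 1) :: r) = p ^ b + topDegree p r := by simp [topDegree]
      have hb : (0 : ℤ) < (p : ℤ) ^ b := pow_pos (by exact_mod_cast hp.out.pos) b
      rw [h, reducedPower, reducedPower_of_topDegree_lt _ (by linarith), zero_add,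
        add_sub_cancel_left, ih]
      rfl

/-! ### The twisted action -/

/-- The `k`-th generator acting on sequences of coefficient functions: it raises the position in
the sequence by one, and from position `m` to `m + 1` it is `P^(k + s m)`. -/
def twistedPower (p : ℕ) (s : ℕ → ℤ) (k : ℤ) : Module.End (ZMod p) (ℕ → List ℕ → ZMod p) where
  toFun Y
    | 0 => 0
    | m + 1 => reducedPower p (k + s m) (Y m)
  map_add' Y Y' := by
    funext m
    cases m with
    | zero => exact (add_zero _).symm
    | succ m => exact reducedPower_add _ _ _
  map_smul' c Y := by
    funext m
    cases m with
    | zero => exact (smul_zero c).symm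
    | succ m => exact reducedPower_smul _ _ _

theorem ademSum_twistedPower {δ : ℤ} {s : ℕ → ℤ} (hs : ∀ m, s (m + 1) = p * s m - 1 + δ) (k : ℤ)
    (n : ℕ) : ademSum (p := p) δ (fun i k => twistedPower p s i * twistedPower p s k) k n = 0 := by
  refine LinearMap.ext fun Y => funext fun m => funext fun r => ?_
  let E : Module.End (ZMod p) (ℕ → List ℕ → ZMod p) →ₗ[ZMod p] ZMod p :=
    { toFun := fun T => T Y m r, map_add' := fun _ _ => rfl, map_smul' := fun _ _ => rfl }
  have h := map_ademSum (p := p) (δ := δ) E (fun i k => twistedPower p s i * twistedPower p s k) k n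
  refine h.trans ?_
  change ademSum δ (fun i k => twistedPower p s i (twistedPower p s k Y) m r) k n = 0
  match m with
  | 0 => exact sum_eq_zero fun j _ => smul_zero _
  | 1 =>
    refine sum_eq_zero fun j _ => ?_
    have : ∀ i, reducedPower p i (0 : List ℕ → ZMod p) = 0 := fun i => by
      simpa using reducedPower_smul i (0 : ZMod p) 0
    change _ • reducedPower p _ (0 : List ℕ → ZMod p) r = 0
    rw [this, Pi.zero_apply, smul_zero]
  | m + 2 =>
    have h1 := ademSum_translate (p := p) (δ := δ)
      (fun i k => reducedPower p i (reducedPower p k (Y m)) r) (s m) k n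
    rw [reducedPower_mem_ademAnnihilator, ← hs] at h1
    exact h1

/-! ### Algebra homomorphisms out of `Q(p)` -/

/-- The parameter `δ` of the Adem relations among the `z_{ε,k}`. -/
def ademShift (ε : Fin 2) : ℤ := if ε = 0 then 1 else 0

theorem ademShift_nonneg (ε : Fin 2) : 0 ≤ ademShift ε := by
  unfold ademShift; split_ifs <;> decide

theorem shift_eq (p : ℕ) (ε : Fin 2) (k : ℤ) : shift p ε k = p * k - ademShift ε := by
  unfold shift ademShift; split_ifs <;> simp

theorem relR_eq (ε : Fin 2) (k : ℤ) (n : ℕ) :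
    relR p ε k n = ademSum (p := p) 1 (fun i k => freeZ p ε i * freeZ p 0 k) k n := by
  rw [ademSum_eq_add, relR]

theorem relS_eq (ε : Fin 2) (k : ℤ) (n : ℕ) :
    relS p ε k n = ademSum (p := p) 0 (fun i k => freeZ p ε i * freeZ p 1 k) k n +
      if ε = 0 then
        ∑ j ∈ Finset.range (n + 1),
          ((-1 : ZMod p) ^ (j + 1) * (binom (((p : ℤ) - 1) * ((n : ℤ) - j)) j : ZMod p)) •
            (freeZ p 1 (p * k - j) * freeZ p 0 (k - n + j))
      else 0 := by
  rw [ademSum_eq_add, relS]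
  simp only [sub_zero]

section

variable {B : Type*} [Ring B] [Algebra (ZMod p) B]

/-- The homomorphism from the free algebra that sends `z_{ε,k}` to `w k` and the generators of the
other kind to zero. -/
def freeLift (ε : Fin 2) (w : ℤ → B) : FreeSteenrod p →ₐ[ZMod p] B :=
  FreeAlgebra.lift (ZMod p) fun x => if x.1 = ε then w x.2 else 0

theorem freeLift_freeZ (ε ε' : Fin 2) (w : ℤ → B) (k : ℤ) :
    freeLift ε w (freeZ p ε' k) = if ε' = ε then w k else 0 :=
  FreeAlgebra.lift_ι_apply _ _

/-- The relations in which both kinds of generators occur have a generator of each kind in each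
of their monomials; hence only the relations among the `z_{ε,k}` survive under `freeLift ε w`. -/
theorem freeLift_rel {ε : Fin 2} {w : ℤ → B}
    (hw : ∀ k n, ademSum (p := p) (ademShift ε) (fun i k => w i * w k) k n = 0)
    {x y : FreeSteenrod p} (h : AdemRel p x y) : freeLift ε w x = freeLift ε w y := by
  have hmap : ∀ (δ : ℤ) (f : ℤ → ℤ → FreeSteenrod p) (k : ℤ) (n : ℕ),
      freeLift ε w (ademSum (p := p) δ f k n) =
        ademSum (p := p) δ (fun i k => freeLift ε w (f i k)) k n :=
    fun δ f k n => map_ademSum (freeLift ε w).toLinearMap f k n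
  have hzero : ∀ (δ : ℤ) (k : ℤ) (n : ℕ),
      ademSum (p := p) δ (fun _ _ => (0 : B)) k n = 0 := fun δ k n => by simp [ademSum]
  cases h with
  | R ε' k n =>
    rw [relR_eq, hmap, map_zero]
    simp only [map_mul, freeLift_freeZ]
    fin_cases ε <;> fin_cases ε'
    · simpa [ademShift] using hw k n
    all_goals simpa using hzero 1 k n
  | S ε' k n =>
    rw [relS_eq, map_add, hmap, map_zero]
    simp only [map_mul, freeLift_freeZ]
    fin_cases ε <;> fin_cases ε'
    · simpa [freeLift_freeZ] using hzero 0 k n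
    · simpa [freeLift_freeZ] using hzero 0 k n
    · simpa [freeLift_freeZ] using hzero 0 k n
    · simpa [ademShift] using hw k n

/-- The homomorphism from `Q(p)` that sends `z_{ε,k}` to `w k` and the generators of the other kind
to zero, for a family `w` satisfying the Adem relations among the `z_{ε,k}`. -/
def liftQ (ε : Fin 2) (w : ℤ → B)
    (hw : ∀ k n, ademSum (p := p) (ademShift ε) (fun i k => w i * w k) k n = 0) :
    Q p →ₐ[ZMod p] B :=
  RingQuot.liftAlgHom (ZMod p) ⟨freeLift ε w, fun _ _ h => freeLift_rel hw h⟩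

theorem liftQ_z {ε : Fin 2} {w : ℤ → B}
    (hw : ∀ k n, ademSum (p := p) (ademShift ε) (fun i k => w i * w k) k n = 0) (ε' : Fin 2)
    (k : ℤ) : liftQ ε w hw (z p ε' k) = if ε' = ε then w k else 0 := by
  rw [liftQ, z, RingQuot.liftAlgHom_mkAlgHom_apply, freeLift_freeZ]

theorem algHom_ext_z {f g : Q p →ₐ[ZMod p] B} (h : ∀ ε k, f (z p ε k) = g (z p ε k)) : f = g :=
  RingQuot.ringQuot_ext' _ _ _ (FreeAlgebra.hom_ext (funext fun x => h x.1 x.2))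

end

/-- The Adem relations among the `z_{ε,k}` hold in `Q(p)`. -/
theorem ademSum_z (ε : Fin 2) (k : ℤ) (n : ℕ) :
    ademSum (p := p) (ademShift ε) (fun i k => z p ε i * z p ε k) k n = 0 := by
  have hmap : ∀ (δ : ℤ), ademSum (p := p) δ (fun i k => z p ε i * z p ε k) k n =
      RingQuot.mkAlgHom (ZMod p) (AdemRel p)
        (ademSum (p := p) δ (fun i k => freeZ p ε i * freeZ p ε k) k n) := fun δ => by
    have := map_ademSum (δ := δ) (RingQuot.mkAlgHom (ZMod p) (AdemRel p)).toLinearMap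
      (fun i k => freeZ p ε i * freeZ p ε k) k n
    refine Eq.trans ?_ this.symm
    simp only [AlgHom.toLinearMap_apply, map_mul, z]
  rw [hmap]
  fin_cases ε
  · have h := RingQuot.mkAlgHom_rel (ZMod p) (AdemRel.R (p := p) 0 k n)
    rw [relR_eq, map_zero] at h
    exact h
  · have h := RingQuot.mkAlgHom_rel (ZMod p) (AdemRel.S (p := p) 1 k n)
    rw [relS_eq, if_neg (by decide), add_zero, map_zero] at h
    exact h

/-- The endomorphism of `Q(p)` that sends `z_{ε,k}` to `z_{ε,pk-δ}` and the generators of the other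
kind to zero. -/
def frob (p : ℕ) [Fact p.Prime] (ε : Fin 2) : Q p →ₐ[ZMod p] Q p :=
  liftQ ε (fun k => z p ε (p * k - ademShift ε)) fun k n => by
    rw [ademSum_rescale (fun i k => z p ε i * z p ε k), ademSum_z]

theorem frob_z_self (ε : Fin 2) (k : ℤ) : frob p ε (z p ε k) = z p ε (p * k - ademShift ε) := by
  rw [frob, liftQ_z, if_pos rfl]

theorem frob_z_of_ne {ε ε' : Fin 2} (h : ε' ≠ ε) (k : ℤ) : frob p ε (z p ε' k) = 0 := by
  rw [frob, liftQ_z, if_neg h]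

/-! ### The length grading -/

/-- The homomorphism from the free algebra to `Q(p)[X]` that multiplies every generator by `X`. -/
noncomputable def freeLengthHom (p : ℕ) : FreeSteenrod p →ₐ[ZMod p] Polynomial (Q p) :=
  FreeAlgebra.lift (ZMod p) fun x => Polynomial.monomial 1 (z p x.1 x.2)

theorem freeLengthHom_freeZ_mul_freeZ {p : ℕ} (ε ε' : Fin 2) (i k : ℤ) :
    freeLengthHom p (freeZ p ε i * freeZ p ε' k) =
      Polynomial.monomial 2 (RingQuot.mkAlgHom (ZMod p) (AdemRel p)
        (freeZ p ε i * freeZ p ε' k)) := by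
  have h : ∀ ε k, freeLengthHom p (freeZ p ε k) = Polynomial.monomial 1 (z p ε k) :=
    fun ε k => FreeAlgebra.lift_ι_apply _ _
  rw [map_mul (freeLengthHom p), h, h, Polynomial.monomial_mul_monomial]
  exact congrArg _ (map_mul (RingQuot.mkAlgHom (ZMod p) (AdemRel p)) _ _).symm

theorem freeLengthHom_rel {p : ℕ} {x y : FreeSteenrod p} (h : AdemRel p x y) :
    freeLengthHom p x = freeLengthHom p y := by
  let L : FreeSteenrod p →ₗ[ZMod p] Polynomial (Q p) :=
    ((Polynomial.monomial 2).restrictScalars (ZMod p)).comp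
      (RingQuot.mkAlgHom (ZMod p) (AdemRel p)).toLinearMap
  have hL : ∀ ε ε' i k, freeLengthHom p (freeZ p ε i * freeZ p ε' k) =
      L (freeZ p ε i * freeZ p ε' k) := freeLengthHom_freeZ_mul_freeZ
  have h0 : freeLengthHom p x = L x := by
    cases h with
    | R ε k n => simp only [relR, map_add, map_sum, map_smul, hL]
    | S ε k n =>
      unfold relS
      split_ifs
      · simp only [map_add, map_sum, map_smul, hL]
      · simp only [map_add, map_sum, map_smul, hL, map_zero]
  have h1 : L x = 0 := by
    have h2 := RingQuot.mkAlgHom_rel (ZMod p) h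
    cases h <;>
    · change Polynomial.monomial 2 (RingQuot.mkAlgHom (ZMod p) (AdemRel p) _) = 0
      rw [h2, map_zero, map_zero]
  rw [h0, h1]
  cases h <;> rw [map_zero]

/-- The homomorphism `Q(p) → Q(p)[X]` that multiplies the elements of length degree `m` by `X ^ m`;
its coefficients are the projections to the length components. -/
noncomputable def lengthHom (p : ℕ) : Q p →ₐ[ZMod p] Polynomial (Q p) :=
  RingQuot.liftAlgHom (ZMod p) ⟨freeLengthHom p, fun _ _ h => freeLengthHom_rel h⟩

theorem lengthHom_z {p : ℕ} (ε : Fin 2) (k : ℤ) :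
    lengthHom p (z p ε k) = Polynomial.monomial 1 (z p ε k) := by
  rw [lengthHom, z, RingQuot.liftAlgHom_mkAlgHom_apply]
  exact FreeAlgebra.lift_ι_apply _ _

theorem lengthHom_prod {p : ℕ} (I : List (Fin 2 × ℤ)) :
    lengthHom p (I.map fun i => z p i.1 i.2).prod =
      Polynomial.monomial I.length (I.map fun i => z p i.1 i.2).prod := by
  induction I with
  | nil => simp
  | cons i I ih =>
    rw [List.map_cons, List.prod_cons, map_mul, ih, lengthHom_z, Polynomial.monomial_mul_monomial,
      List.length_cons, add_comm]

theorem lengthHom_of_mem {p m : ℕ} {x : Q p} (hx : x ∈ lengthPart p m) :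
    lengthHom p x = Polynomial.monomial m x := by
  have : lengthPart p m ≤ LinearMap.eqLocus (lengthHom p).toLinearMap
      ((Polynomial.monomial m).restrictScalars (ZMod p)) := by
    refine Submodule.span_le.2 ?_
    rintro _ ⟨I, rfl, rfl⟩
    exact lengthHom_prod I
  exact this hx

theorem adjoin_z_induction {p : ℕ} {S : Set (Q p)} (hS : ∀ x ∈ S, ∃ ε k, x = z p ε k)
    {P : Submodule (ZMod p) (Q p)}
    (hP : ∀ I : List (Fin 2 × ℤ), (I.map fun i => z p i.1 i.2).prod ∈ Algebra.adjoin (ZMod p) S →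
      (I.map fun i => z p i.1 i.2).prod ∈ P) {x : Q p} (hx : x ∈ Algebra.adjoin (ZMod p) S) :
    x ∈ P := by
  have hcl : ∀ y ∈ Submonoid.closure S, ∃ I : List (Fin 2 × ℤ),
      y = (I.map fun i => z p i.1 i.2).prod := by
    intro y hy
    induction hy using Submonoid.closure_induction with
    | mem y hy => obtain ⟨ε, k, rfl⟩ := hS y hy; exact ⟨[(ε, k)], by simp⟩
    | one => exact ⟨[], rfl⟩
    | mul y y' _ _ h h' =>
      obtain ⟨I, rfl⟩ := h
      obtain ⟨I', rfl⟩ := h'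
      exact ⟨I ++ I', by simp⟩
  have h : Subalgebra.toSubmodule (Algebra.adjoin (ZMod p) S) ≤ P := by
    rw [Algebra.adjoin_eq_span, Submodule.span_le]
    intro y hy
    have hy' : y ∈ Algebra.adjoin (ZMod p) S := by
      rw [← Subalgebra.mem_toSubmodule, Algebra.adjoin_eq_span]
      exact Submodule.subset_span hy
    obtain ⟨I, rfl⟩ := hcl y hy
    exact hP I hy'
  exact h hx

/-- The length components of an element of a subalgebra generated by some of the `z_{ε,k}` belong to
that subalgebra. -/
theorem coeff_lengthHom_mem_adjoin {p : ℕ} {S : Set (Q p)} (hS : ∀ x ∈ S, ∃ ε k, x = z p ε k)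
    {x : Q p} (hx : x ∈ Algebra.adjoin (ZMod p) S) (m : ℕ) :
    (lengthHom p x).coeff m ∈ Algebra.adjoin (ZMod p) S := by
  refine adjoin_z_induction hS (P := (Subalgebra.toSubmodule (Algebra.adjoin (ZMod p) S)).comap
    (((Polynomial.lcoeff (Q p) m).restrictScalars (ZMod p)).comp (lengthHom p).toLinearMap))
    (fun I hI => ?_) hx
  change (lengthHom p _).coeff m ∈ Algebra.adjoin (ZMod p) S
  rw [lengthHom_prod, Polynomial.coeff_monomial]
  split_ifs
  · exact hI
  · exact zero_mem _

theorem mem_lengthPart_iff {p : ℕ} {S : Set (Q p)} (hS : ∀ x ∈ S, ∃ ε k, x = z p ε k) {x : Q p}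
    (hx : x ∈ Algebra.adjoin (ZMod p) S) {m : ℕ} :
    x ∈ lengthPart p m ↔ lengthHom p x = Polynomial.monomial m x := by
  refine ⟨lengthHom_of_mem, fun h => ?_⟩
  have hmem : (lengthHom p x).coeff m ∈ lengthPart p m := by
    refine adjoin_z_induction hS (P := (lengthPart p m).comap
      (((Polynomial.lcoeff (Q p) m).restrictScalars (ZMod p)).comp (lengthHom p).toLinearMap))
      (fun I _ => ?_) hx
    change (lengthHom p _).coeff m ∈ lengthPart p m
    rw [lengthHom_prod, Polynomial.coeff_monomial]
    split_ifs with hI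
    · exact Submodule.subset_span ⟨I, hI, rfl⟩
    · exact zero_mem _
  rwa [h, Polynomial.coeff_monomial, if_pos rfl] at hmem

theorem isInternal_subLengthPart_adjoin {p : ℕ} {S : Set (Q p)}
    (hS : ∀ x ∈ S, ∃ ε k, x = z p ε k) :
    DirectSum.IsInternal (subLengthPart (Algebra.adjoin (ZMod p) S)) := by
  set A := Algebra.adjoin (ZMod p) S with hA
  have hcoeff : ∀ (v : DirectSum ℕ fun m => subLengthPart A m) (m : ℕ),
      (lengthHom p (DirectSum.coeLinearMap (subLengthPart A) v : A)).coeff m = (v m : A) := by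
    intro v m
    induction v using DirectSum.induction_on with
    | zero => simp
    | of i x =>
      have hx : ((x : A) : Q p) ∈ lengthPart p i := x.2
      change (lengthHom p (DirectSum.coeLinearMap (subLengthPart A)
        (DirectSum.lof (ZMod p) ℕ _ i x) : A)).coeff m = _
      rw [DirectSum.coeLinearMap_lof, lengthHom_of_mem hx, Polynomial.coeff_monomial]
      split_ifs with him
      · subst him; rw [DirectSum.of_eq_same]
      · rw [DirectSum.of_eq_of_ne _ _ _ (Ne.symm him)]; rfl
    | add v w hv hw =>
      rw [map_add, Subalgebra.coe_add, map_add, Polynomial.coeff_add, hv, hw]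
      rfl
  refine ⟨fun v w hvw => ?_, fun x => ?_⟩
  · refine DFinsupp.ext fun m => Subtype.ext (Subtype.ext ?_)
    rw [← hcoeff v m, ← hcoeff w m]
    exact congrArg (fun y : A => (lengthHom p (y : Q p)).coeff m) hvw
  · have h : (x : Q p) ∈ (LinearMap.range (DirectSum.coeLinearMap (subLengthPart A))).map
        A.val.toLinearMap := by
      refine adjoin_z_induction hS (fun I hI => ?_) x.2
      refine ⟨⟨_, hI⟩, ?_, rfl⟩
      rw [DirectSum.range_coeLinearMap]
      exact Submodule.mem_iSup_of_mem I.length (Submodule.subset_span ⟨I, rfl, rfl⟩)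
    obtain ⟨y, ⟨v, rfl⟩, hy⟩ := h
    exact ⟨v, Subtype.ext hy⟩

theorem lengthHom_frob_pow (ε : Fin 2) (s : ℕ) (x : Q p) :
    lengthHom p ((frob p ε ^ s) x) = 
      Polynomial.mapAlgHom (frob p ε ^ s) (lengthHom p x) := by
  have h1 : (lengthHom p).comp (frob p ε) =
      (Polynomial.mapAlgHom (frob p ε)).comp (lengthHom p) := by
    refine algHom_ext_z (p := p) (B := Polynomial (Q p)) fun ε' k => ?_
    rw [AlgHom.comp_apply, AlgHom.comp_apply, lengthHom_z, Polynomial.mapAlgHom_monomial]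
    by_cases h : ε' = ε
    · rw [h, frob_z_self, lengthHom_z]
    · rw [frob_z_of_ne h, map_zero, map_zero]
  induction s generalizing x with
  | zero =>
    ext m
    simp
  | succ s ih =>
    rw [pow_succ, AlgHom.mul_apply, ih]
    have := DFunLike.congr_fun h1 x
    rw [AlgHom.comp_apply, AlgHom.comp_apply] at this
    rw [this]
    ext m
    simp

/-! ### The basis of admissible monomials -/

/-- The monomial `z_{ε,i₁} ⋯ z_{ε,i_m}`. -/
def monomialZ (p : ℕ) (ε : Fin 2) (I : List ℤ) : Q p := (I.map (z p ε)).prod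

/-- A monomial is admissible if it contains no leading monomial `z_{pk-δ-n} z_k` of an Adem
relation. -/
def IsAdmissible (p : ℕ) (δ : ℤ) (I : List ℤ) : Prop := I.IsChain fun i k => p * k - δ < i

/-- The bounds on the indices that are preserved by the Adem relations: an index followed by `t`
others is at most `p ^ t * b`. -/
def IsBounded (p : ℕ) (b : ℤ) : List ℤ → Prop
  | [] => True
  | i :: I => i ≤ p ^ I.length * b ∧ IsBounded p b I

/-- The distances of the indices from their bounds, weighted by position. Replacing the leading
monomial of an Adem relation by one of the others moves some of the distance to the right, where it
has smaller weight. -/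
def defect (p : ℕ) (b : ℤ) : List ℤ → ℤ
  | [] => 0
  | i :: I => I.length * (p ^ I.length * b - i) + defect p b I

theorem defect_nonneg {p : ℕ} {b : ℤ} {I : List ℤ} (h : IsBounded p b I) : 0 ≤ defect p b I := by
  induction I with
  | nil => exact le_rfl
  | cons i I ih =>
    exact add_nonneg (mul_nonneg (Int.natCast_nonneg _) (sub_nonneg.2 h.1)) (ih h.2)

theorem exists_isBounded (I : List ℤ) : ∃ b : ℤ, 0 ≤ b ∧ IsBounded p b I := by
  have hp1 : ∀ t : ℕ, (1 : ℤ) ≤ (p : ℤ) ^ t := fun t =>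
    one_le_pow₀ (by exact_mod_cast hp.out.one_le)
  have hmono : ∀ (J : List ℤ) (b c : ℤ), b ≤ c → IsBounded p b J → IsBounded p c J := by
    intro J b c hbc
    induction J with
    | nil => exact fun _ => trivial
    | cons i J ih =>
      exact fun h => ⟨h.1.trans (mul_le_mul_of_nonneg_left hbc (by positivity)), ih h.2⟩
  induction I with
  | nil => exact ⟨0, le_rfl, trivial⟩
  | cons i I ih =>
    obtain ⟨b, hb, h⟩ := ih
    refine ⟨max b i, le_max_of_le_left hb, ?_, hmono I _ _ (le_max_left _ _) h⟩
    calc i ≤ max b i := le_max_right _ _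
      _ ≤ p ^ I.length * max b i := le_mul_of_one_le_left (le_max_of_le_left hb) (hp1 _)

theorem isBounded_replace {p : ℕ} {b : ℤ} {L R : List ℤ} {i k i' k' : ℤ} (hi : i' ≤ p * k) (hk : k' ≤ k)
    (h : IsBounded p b (L ++ i :: k :: R)) : IsBounded p b (L ++ i' :: k' :: R) := by
  induction L with
  | nil =>
    refine ⟨?_, hk.trans h.2.1, h.2.2⟩
    calc i' ≤ p * k := hi
      _ ≤ p * (p ^ R.length * b) := mul_le_mul_of_nonneg_left h.2.1 (by positivity)
      _ = p ^ (k' :: R).length * b := by rw [List.length_cons, pow_succ']; ring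
  | cons a L ih =>
    refine ⟨?_, ih h.2⟩
    have h1 : a ≤ p ^ (L ++ i :: k :: R).length * b := h.1
    change a ≤ p ^ (L ++ i' :: k' :: R).length * b
    simpa using h1

theorem defect_replace {p : ℕ} {b : ℤ} {L R : List ℤ} {i k i' k' d : ℤ} (hi : i' = i + d)
    (hk : k' = k - d) : defect p b (L ++ i' :: k' :: R) = defect p b (L ++ i :: k :: R) - d := by
  subst hi hk
  induction L with
  | nil =>
    simp only [List.nil_append, defect, List.length_cons]
    push_cast
    ring
  | cons a L ih =>
    simp only [List.cons_append, defect, List.length_append, List.length_cons, ih]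
    ring

theorem monomialZ_append {p : ℕ} (ε : Fin 2) (L R : List ℤ) :
    monomialZ p ε (L ++ R) = monomialZ p ε L * monomialZ p ε R := by
  simp [monomialZ]

/-- Rewriting the leading monomial of an Adem relation inside a longer monomial. -/
theorem monomialZ_eq_neg_sum (ε : Fin 2) (L R : List ℤ) (k : ℤ) (n : ℕ) :
    monomialZ p ε (L ++ (p * k - ademShift ε - n) :: k :: R) =
      -∑ j ∈ range n, ademCoeff p n j •
        monomialZ p ε (L ++ (p * k - ademShift ε - j) :: (k - n + j) :: R) := by
  have hm : ∀ i k : ℤ, monomialZ p ε (L ++ i :: k :: R) =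
      monomialZ p ε L * (z p ε i * z p ε k) * monomialZ p ε R := fun i k => by
    simp [monomialZ, mul_assoc]
  have h := map_ademSum (p := p) (δ := ademShift ε)
    ((LinearMap.mulRight (ZMod p) (monomialZ p ε R)).comp
      (LinearMap.mulLeft (ZMod p) (monomialZ p ε L))) (fun i k => z p ε i * z p ε k) k n
  rw [ademSum_z, map_zero, ademSum_eq_sum_add] at h
  simp only [hm]
  exact eq_neg_of_add_eq_zero_right h.symm

theorem monomialZ_mem_span_admissible (ε : Fin 2) (I : List ℤ) :
    monomialZ p ε I ∈ Submodule.span (ZMod p)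
      (monomialZ p ε '' {J | IsAdmissible p (ademShift ε) J}) := by
  obtain ⟨b, -, hb⟩ := exists_isBounded (p := p) I
  induction hN : (defect p b I).toNat using Nat.strong_induction_on generalizing I with
  | _ N ih =>
    by_cases hI : IsAdmissible p (ademShift ε) I
    · exact Submodule.subset_span ⟨I, hI, rfl⟩
    · rw [IsAdmissible, List.isChain_iff_forall_rel_of_append_cons_cons] at hI
      push Not at hI
      obtain ⟨i, k, L, R, rfl, hik⟩ := hI
      obtain ⟨n, rfl⟩ : ∃ n : ℕ, i = p * k - ademShift ε - n :=
        ⟨(p * k - ademShift ε - i).toNat, by omega⟩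
      rw [monomialZ_eq_neg_sum]
      refine neg_mem (sum_mem fun j hj => Submodule.smul_mem _ _ ?_)
      have hjn : j < n := mem_range.1 hj
      have hδ := ademShift_nonneg ε
      have hb' : IsBounded p b (L ++ (p * k - ademShift ε - j) :: (k - n + j) :: R) :=
        isBounded_replace (by omega) (by omega) hb
      have hd := defect_replace (p := p) (b := b) (L := L) (R := R)
        (show p * k - ademShift ε - (j : ℤ) = p * k - ademShift ε - n + ((n : ℤ) - j) by ring)
        (show k - (n : ℤ) + j = k - (n - j) by ring)
      have h0 := defect_nonneg hb'
      exact ih _ (by omega) _ hb' rfl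

theorem Qeps_le_span_admissible (ε : Fin 2) :
    Subalgebra.toSubmodule (Qeps p ε) ≤ Submodule.span (ZMod p)
      (monomialZ p ε '' {J | IsAdmissible p (ademShift ε) J}) := by
  rw [Qeps, Algebra.adjoin_eq_span, Submodule.span_le]
  intro x hx
  obtain ⟨I, rfl⟩ : ∃ I, x = monomialZ p ε I := by
    induction hx using Submonoid.closure_induction with
    | mem y hy => obtain ⟨k, rfl⟩ := hy; exact ⟨[k], by simp [monomialZ]⟩
    | one => exact ⟨[], rfl⟩
    | mul y y' _ _ h h' =>
      obtain ⟨I, rfl⟩ := h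
      obtain ⟨I', rfl⟩ := h'
      exact ⟨I ++ I', (monomialZ_append ε I I').symm⟩
  exact monomialZ_mem_span_admissible ε I

/-- The twists of the action: the solution of `s (m + 1) = p * s m - 1 + δ` with `s 0 = c`. -/
def twist (p : ℕ) (δ c : ℤ) : ℕ → ℤ
  | 0 => c
  | m + 1 => p * twist p δ c m - 1 + δ

/-- The representation of `Q(p)` on sequences of coefficient functions, by twisted reduced
powers. -/
noncomputable def twistedRep (p : ℕ) [Fact p.Prime] (ε : Fin 2) (c : ℤ) :
    Q p →ₐ[ZMod p] Module.End (ZMod p) (ℕ → List ℕ → ZMod p) :=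
  liftQ ε (twistedPower p (twist p (ademShift ε) c)) (ademSum_twistedPower fun _ => rfl)

/-- The vector on which the monomials are evaluated: in position `0`, the product of the variables
(for any number of variables), and zero in all other positions. -/
def productVector (p : ℕ) : ℕ → List ℕ → ZMod p :=
  fun m r => if m = 0 ∧ ∀ a ∈ r, a = 0 then 1 else 0

/-- Every twisted index is the largest possible one in the production of the monomial with
exponents `r` from the product of the variables. -/
def IsTop (p : ℕ) (s : ℕ → ℤ) : List ℤ → List ℕ → Prop
  | [], r => ∀ a ∈ r, a = 0
  | i :: I, r => i + s I.length = topDegree p r ∧ IsTop p s I (r.map Nat.pred)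

theorem twistedRep_cons (ε : Fin 2) (c i : ℤ) (I : List ℤ) (Y : ℕ → List ℕ → ZMod p) (m : ℕ) :
    twistedRep p ε c (monomialZ p ε (i :: I)) Y (m + 1) =
      reducedPower p (i + twist p (ademShift ε) c m)
        (twistedRep p ε c (monomialZ p ε I) Y m) := by
  rw [monomialZ, List.map_cons, List.prod_cons, map_mul, twistedRep, liftQ_z, if_pos rfl]
  rfl

theorem twistedRep_productVector_of_length_ne (ε : Fin 2) (c : ℤ) {I : List ℤ} {m : ℕ}
    (h : I.length ≠ m) : twistedRep p ε c (monomialZ p ε I) (productVector p) m = 0 := by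
  induction I generalizing m with
  | nil =>
    funext r
    simp only [monomialZ, List.map_nil, List.prod_nil, map_one, Module.End.one_apply]
    exact if_neg fun h' => h h'.1.symm
  | cons i I ih =>
    cases m with
    | zero =>
      rw [monomialZ, List.map_cons, List.prod_cons, map_mul, twistedRep, liftQ_z, if_pos rfl]
      rfl
    | succ m =>
      rw [twistedRep_cons, ih (by simpa using h)]
      simpa using reducedPower_smul (p := p) (i + twist p (ademShift ε) c m) 0 0

theorem twistedRep_of_isTop (ε : Fin 2) (c : ℤ) {I : List ℤ} {r : List ℕ}
    (h : IsTop p (twist p (ademShift ε) c) I r) :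
    twistedRep p ε c (monomialZ p ε I) (productVector p) I.length r = 1 := by
  induction I generalizing r with
  | nil =>
    simp only [monomialZ, List.map_nil, List.prod_nil, map_one, Module.End.one_apply]
    exact if_pos ⟨rfl, h⟩
  | cons i I ih =>
    rw [List.length_cons, twistedRep_cons, h.1, reducedPower_topDegree, ih h.2]

theorem twistedRep_of_lt (ε : Fin 2) (c : ℤ) {I J : List ℤ} {r : List ℕ}
    (h : IsTop p (twist p (ademShift ε) c) I r) (hIJ : I < J) (hlen : J.length = I.length) :
    twistedRep p ε c (monomialZ p ε J) (productVector p) I.length r = 0 := by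
  induction I generalizing J r with
  | nil =>
    rw [List.length_nil, List.length_eq_zero_iff] at hlen
    subst hlen
    exact absurd hIJ (lt_irrefl _)
  | cons i I ih =>
    cases J with
    | nil => simp at hlen
    | cons k J =>
      rw [List.length_cons, twistedRep_cons]
      rcases List.cons_lt_cons_iff.1 hIJ with hik | ⟨rfl, hIJ'⟩
      · exact reducedPower_of_topDegree_lt _ (by rw [← h.1]; linarith)
      · rw [h.1, reducedPower_topDegree]
        exact ih h.2 hIJ' (by simpa using hlen)

theorem topDegree_append_zeros (p : ℕ) (r : List ℕ) (t : ℕ) :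
    topDegree p (r ++ List.replicate t 0) = topDegree p r := by
  simp [topDegree]

theorem IsTop.append_zeros {p : ℕ} {s : ℕ → ℤ} {I : List ℤ} {r : List ℕ} (h : IsTop p s I r) (t : ℕ) :
    IsTop p s I (r ++ List.replicate t 0) := by
  induction I generalizing r with
  | nil =>
    intro a ha
    rcases List.mem_append.1 ha with ha | ha
    · exact h a ha
    · exact List.eq_of_mem_replicate ha
  | cons i I ih =>
    refine ⟨by rw [topDegree_append_zeros]; exact h.1, ?_⟩
    rw [List.map_append, List.map_replicate]
    exact ih h.2

/-- An admissible monomial is the top one for some `r`: in the step with index `i` the exponents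
already present are raised, and `i - p k` new variables (in terms of the twisted indices) start to
be raised. -/
theorem exists_isTop {p : ℕ} {δ c : ℤ} {I : List ℤ} (hI : IsAdmissible p δ I) (hc : ∀ i ∈ I, 0 ≤ i + c) :
    ∃ r : List ℕ, (∀ a ∈ r, a ≠ 0) ∧ IsTop p (twist p δ c) I r := by
  induction I with
  | nil => exact ⟨[], by simp, by simp [IsTop]⟩
  | cons i I ih =>
    obtain ⟨r, hr, htop⟩ := ih hI.tail fun k hk => hc k (List.mem_cons_of_mem _ hk)
    have hle : p * topDegree p r ≤ i + twist p δ c I.length := by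
      cases I with
      | nil =>
        have : topDegree p r = 0 := by
          rw [List.eq_nil_iff_forall_not_mem.2 fun a ha => hr a ha (htop a ha)]
          rfl
        rw [this, mul_zero]
        exact hc i (List.mem_cons_self ..)
      | cons k I =>
        have h1 : p * k - δ < i := (List.isChain_cons_cons.1 hI).1
        have h2 : k + twist p δ c I.length = topDegree p r := htop.1
        rw [← h2, List.length_cons, twist]
        linarith
    obtain ⟨t, ht⟩ := Int.eq_ofNat_of_zero_le (sub_nonneg.2 hle)
    refine ⟨r.map Nat.succ ++ List.replicate t 1, ?_, ?_, ?_⟩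
    · intro a ha
      rcases List.mem_append.1 ha with ha | ha
      · obtain ⟨b, -, rfl⟩ := List.mem_map.1 ha
        exact b.succ_ne_zero
      · rw [List.eq_of_mem_replicate ha]
        exact one_ne_zero
    · have h1 : topDegree p (r.map Nat.succ ++ List.replicate t 1) = p * topDegree p r + t := by
        have h2 : ∀ r : List ℕ, (∀ a ∈ r, a ≠ 0) →
            topDegree p (r.map Nat.succ ++ List.replicate t 1) = p * topDegree p r + t := by
          intro r hr
          induction r with
          | nil => simp [topDegree]
          | cons a r ih =>
            have ha : a ≠ 0 := hr a (List.mem_cons_self ..)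
            have := ih fun b hb => hr b (List.mem_cons_of_mem _ hb)
            obtain ⟨b, rfl⟩ := Nat.exists_eq_succ_of_ne_zero ha
            simp only [topDegree, List.map_cons, List.cons_append, List.sum_cons] at this ⊢
            rw [this]
            simp [pow_succ]
            ring
        exact h2 r hr
      rw [h1]
      linarith
    · have : (r.map Nat.succ ++ List.replicate t 1).map Nat.pred = r ++ List.replicate t 0 := by
        simp [Function.comp_def]
      rw [this]
      exact htop.append_zeros t

/-- The admissible monomials in the `z_{ε,k}` are linearly independent in `Q(p)`. Evaluating a
relation at the exponents for which its lexicographically smallest monomial is the top one isolates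
the coefficient of that monomial. -/
theorem linearIndependent_admissible (ε : Fin 2) :
    LinearIndependent (ZMod p)
      fun I : {I : List ℤ // IsAdmissible p (ademShift ε) I} => monomialZ p ε I := by
  rw [linearIndependent_iff']
  by_contra hne
  push Not at hne
  obtain ⟨S, g, hsum, I₁, hI₁, hg₁⟩ := hne
  obtain ⟨I₀, hI₀, hmin⟩ := Finset.exists_min_image
    (S.filter fun I => g I ≠ 0 ∧ I.1.length = I₁.1.length) (fun I => I.1)
    ⟨I₁, Finset.mem_filter.2 ⟨hI₁, hg₁, rfl⟩⟩
  obtain ⟨hI₀S, hg₀, hlen₀⟩ := Finset.mem_filter.1 hI₀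
  obtain ⟨c, hc⟩ : ∃ c : ℤ, ∀ i ∈ I₀.1, 0 ≤ i + c := by
    refine ⟨(I₀.1.map fun i => |i|).sum, fun i hi => ?_⟩
    have h1 : |i| ≤ (I₀.1.map fun i => |i|).sum :=
      List.single_le_sum (fun x hx => by
        obtain ⟨y, -, rfl⟩ := List.mem_map.1 hx
        exact abs_nonneg y) _ (List.mem_map.2 ⟨i, hi, rfl⟩)
    linarith [neg_abs_le i]
  obtain ⟨r, -, hr⟩ := exists_isTop I₀.2 hc
  have h := congrArg (fun x => twistedRep p ε c x (productVector p) I₀.1.length r) hsum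
  simp only [map_sum, map_smul, LinearMap.sum_apply, LinearMap.smul_apply, Finset.sum_apply,
    Pi.smul_apply, map_zero, LinearMap.zero_apply, Pi.zero_apply, smul_eq_mul] at h
  rw [Finset.sum_eq_single I₀ ?_ fun h' => absurd hI₀S h', twistedRep_of_isTop ε c hr, mul_one] at h
  · exact hg₀ h
  · intro J hJ hJI
    by_cases hgJ : g J = 0
    · rw [hgJ, zero_mul]
    by_cases hlen : J.1.length = I₀.1.length
    · have hle := hmin J (Finset.mem_filter.2 ⟨hJ, hgJ, hlen.trans hlen₀⟩)
      rw [twistedRep_of_lt ε c hr (lt_of_le_of_ne hle fun h' => hJI (Subtype.ext h'.symm)) hlen,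
        mul_zero]
    · rw [twistedRep_productVector_of_length_ne ε c hlen, Pi.zero_apply, mul_zero]

/-! ### Injectivity of the endomorphism -/

theorem frob_monomialZ (ε : Fin 2) (I : List ℤ) :
    frob p ε (monomialZ p ε I) = monomialZ p ε (I.map fun k => p * k - ademShift ε) := by
  simp only [monomialZ, map_list_prod, List.map_map]
  congr 2
  funext k
  exact frob_z_self ε k

theorem IsAdmissible.rescale {ε : Fin 2} {I : List ℤ} (h : IsAdmissible p (ademShift ε) I) :
    IsAdmissible p (ademShift ε) (I.map fun k => p * k - ademShift ε) := by
  refine (List.isChain_map _).2 (h.imp fun i k hik => ?_)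
  have h1 : (p : ℤ) * (p * k - ademShift ε) < p * i :=
    mul_lt_mul_of_pos_left hik (by exact_mod_cast hp.out.pos)
  linarith

theorem injOn_frob (ε : Fin 2) : Set.InjOn (frob p ε) (Qeps p ε) := by
  let b := fun I : {I : List ℤ // IsAdmissible p (ademShift ε) I} => monomialZ p ε I
  let σ : {I : List ℤ // IsAdmissible p (ademShift ε) I} →
      {I : List ℤ // IsAdmissible p (ademShift ε) I} := fun I => ⟨_, I.2.rescale⟩
  have hσ : Function.Injective σ := fun I J h => by
    refine Subtype.ext (List.map_injective_iff.2 (fun i k hik => ?_) (congrArg Subtype.val h))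
    exact mul_left_cancel₀ (by exact_mod_cast hp.out.ne_zero) (sub_left_injective hik)
  have hli : LinearIndependent (ZMod p) ((frob p ε).toLinearMap ∘ b) := by
    have : (frob p ε).toLinearMap ∘ b = b ∘ σ := funext fun I => frob_monomialZ ε I
    rw [this]
    exact (linearIndependent_admissible ε).comp σ hσ
  have hker : ∀ x ∈ Qeps p ε, frob p ε x = 0 → x = 0 := by
    intro x hx h0
    have hx' : x ∈ Submodule.span (ZMod p) (Set.range b) := by
      have := Qeps_le_span_admissible ε hx
      rwa [Set.image_eq_range] at this
    obtain ⟨c, rfl⟩ := (Finsupp.mem_span_range_iff_exists_finsupp).1 hx'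
    have : c = 0 := by
      refine (linearIndependent_iff.1 hli) c ?_
      rw [← h0, Finsupp.linearCombination_apply, Finsupp.sum, Finsupp.sum, map_sum]
      simp
    rw [this, Finsupp.sum_zero_index]
  intro x hx y hy hxy
  exact sub_eq_zero.1 (hker _ (sub_mem hx hy) (by rw [map_sub, hxy, sub_self]))

/-! ### The descending chain -/

theorem frob_pow_z (ε : Fin 2) (s : ℕ) (k : ℤ) : (frob p ε ^ s) (z p ε k) =
    z p ε ((p : ℤ) ^ s * k - if ε = 0 then ∑ i ∈ range s, (p : ℤ) ^ i else 0) := by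
  induction s generalizing k with
  | zero => simp
  | succ s ih =>
    rw [pow_succ, AlgHom.mul_apply, frob_z_self, ih, ademShift, sum_range_succ]
    congr 1
    split_ifs <;> ring

theorem Qchain_eq_map (ε : Fin 2) (s : ℕ) :
    Qchain p ε s = (Qeps p ε).map (frob p ε ^ s) := by
  rw [Qeps, AlgHom.map_adjoin, ← Set.range_comp, Qchain]
  congr 2
  funext k
  exact (frob_pow_z ε s k).symm

theorem frob_mem_Qeps {ε : Fin 2} {x : Q p} (hx : x ∈ Qeps p ε) : frob p ε x ∈ Qeps p ε := by
  have h : (Qeps p ε).map (frob p ε) ≤ Qeps p ε := by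
    conv_lhs => rw [Qeps, AlgHom.map_adjoin]
    refine Algebra.adjoin_le ?_
    rintro _ ⟨_, ⟨k, rfl⟩, rfl⟩
    rw [frob_z_self]
    exact z_mem_Qeps p ε _
  exact h ⟨x, hx, rfl⟩

theorem injOn_frob_pow (ε : Fin 2) (s : ℕ) : Set.InjOn (frob p ε ^ s) (Qeps p ε) := by
  induction s with
  | zero => exact fun x _ y _ h => h
  | succ s ih =>
    intro x hx y hy h
    rw [pow_succ, AlgHom.mul_apply, AlgHom.mul_apply] at h
    exact injOn_frob ε hx hy (ih (frob_mem_Qeps hx) (frob_mem_Qeps hy) h)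

/-- An element of `Q^ε` has length degree `m` if and only if its image in `Q^ε_s` has. -/
theorem frob_pow_mem_lengthPart_iff (ε : Fin 2) (s m : ℕ) {x : Q p} (hx : x ∈ Qeps p ε) :
    (frob p ε ^ s) x ∈ lengthPart p m ↔ x ∈ lengthPart p m := by
  have hS : ∀ x ∈ Set.range (z p ε), ∃ ε k, x = z p ε k := by
    rintro _ ⟨k, rfl⟩
    exact ⟨ε, k, rfl⟩
  have hmem : ∀ (t : ℕ) {y : Q p}, y ∈ Qeps p ε → (frob p ε ^ t) y ∈ Qeps p ε := by
    intro t
    induction t with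
    | zero => exact fun hy => hy
    | succ t ih =>
        intro y hy
        rw [pow_succ, AlgHom.mul_apply]
        exact ih (frob_mem_Qeps hy)
  rw [mem_lengthPart_iff hS (hmem s hx), mem_lengthPart_iff hS hx, lengthHom_frob_pow]
  refine ⟨fun h => Polynomial.ext fun i => ?_, fun h => ?_⟩
  · have hi := congrArg (Polynomial.coeff · i) h
    rw [Polynomial.coe_mapAlgHom] at hi
    simp only [Polynomial.coeff_map, Polynomial.coeff_monomial] at hi ⊢
    refine injOn_frob_pow ε s (coeff_lengthHom_mem_adjoin hS hx i) ?_ ?_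
    · split_ifs
      · exact hx
      · exact zero_mem (Qeps p ε)
    · refine hi.trans ?_
      split_ifs
      · rfl
      · exact (map_zero _).symm
  · rw [h, Polynomial.mapAlgHom_monomial]

theorem Qchain_succ_lt (hp2 : p ≠ 2) (ε : Fin 2) (s : ℕ) :
    Qchain p ε (s + 1) < Qchain p ε s := by
  have hgen : ∀ t (m : ℤ), z p ε ((p : ℤ) ^ t * m -
      if ε = 0 then ∑ i ∈ range t, (p : ℤ) ^ i else 0) ∈ Qchain p ε t :=
    fun t m => Algebra.subset_adjoin ⟨m, rfl⟩
  have hidx : ∀ m : ℤ, (p : ℤ) ^ (s + 1) * m - (if ε = 0 then ∑ i ∈ range (s + 1), (p : ℤ) ^ i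
      else 0) = (p : ℤ) ^ s * (p * m - ademShift ε) -
        if ε = 0 then ∑ i ∈ range s, (p : ℤ) ^ i else 0 := by
    intro m
    rw [ademShift, sum_range_succ]
    split_ifs <;> ring
  refine lt_of_le_not_ge (Algebra.adjoin_le ?_) fun hle => ?_
  · rintro _ ⟨m, rfl⟩
    dsimp only
    rw [hidx]
    exact hgen s _
  · set k₀ : ℤ := (p : ℤ) ^ s * 1 - if ε = 0 then ∑ i ∈ range s, (p : ℤ) ^ i else 0 with hk₀
    -- all quadratic relations hold among multiples of a dual number of square zero
    have hw : ∀ k n, ademSum (p := p) (ademShift ε) (fun i k =>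
        (if i = k₀ then DualNumber.eps else 0 : DualNumber (ZMod p)) *
          if k = k₀ then DualNumber.eps else 0) k n = 0 := fun k n => by
      refine sum_eq_zero fun j _ => ?_
      dsimp only
      split_ifs <;> simp [DualNumber.eps_mul_eps]
    let D : Q p →ₐ[ZMod p] DualNumber (ZMod p) :=
      liftQ ε (fun k => if k = k₀ then DualNumber.eps else 0) hw
    have hDz : ∀ k, D (z p ε k) = if k = k₀ then DualNumber.eps else 0 := fun k => by
      rw [liftQ_z hw, if_pos rfl]
    have hD : Qchain p ε (s + 1) ≤ (⊥ : Subalgebra (ZMod p) (DualNumber (ZMod p))).comap D := by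
      refine Algebra.adjoin_le ?_
      rintro _ ⟨m, rfl⟩
      -- `p m - δ = 1` would make `p` a divisor of `1 + δ`, which is `1` or `2`
      have hne : (p : ℤ) ^ s * (p * m - ademShift ε) -
          (if ε = 0 then ∑ i ∈ range s, (p : ℤ) ^ i else 0) ≠ k₀ := by
        intro h
        have h1 : (p : ℤ) * m - ademShift ε = 1 := by
          refine mul_left_cancel₀ (pow_ne_zero s (Nat.cast_ne_zero.2 hp.out.ne_zero) : (p : ℤ) ^ s ≠ 0) ?_
          linarith
        have h2 : (p : ℤ) ∣ 1 + ademShift ε := ⟨m, by linarith⟩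
        have h3 : p ∣ 2 := by
          unfold ademShift at h2
          split_ifs at h2
          · exact_mod_cast h2
          · exact (by exact_mod_cast h2 : p ∣ 1).trans (one_dvd 2)
        exact hp2 ((Nat.prime_dvd_prime_iff_eq hp.out Nat.prime_two).1 h3)
      change D (z p ε _) ∈ (⊥ : Subalgebra (ZMod p) (DualNumber (ZMod p)))
      rw [hidx, hDz, if_neg hne]
      exact zero_mem _
    have h := hD (hle (hgen s 1))
    change D (z p ε k₀) ∈ (⊥ : Subalgebra (ZMod p) (DualNumber (ZMod p))) at h
    rw [hDz, if_pos rfl] at h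
    obtain ⟨a, ha⟩ := Algebra.mem_bot.1 h
    exact zero_ne_one (α := ZMod p) (congrArg TrivSqZeroExt.snd ha)

end SteenrodFractal

open SteenrodFractal in
theorem theorem1p1 (p : ℕ) [Fact p.Prime] (hp : p ≠ 2) (ε : Fin 2) :
    SteenrodFractal.Qchain p ε 0 = SteenrodFractal.Qeps p ε ∧
    (∀ s : ℕ, SteenrodFractal.Qchain p ε (s + 1) < SteenrodFractal.Qchain p ε s) ∧
    (∀ s : ℕ, DirectSum.IsInternal
      (SteenrodFractal.subLengthPart (SteenrodFractal.Qchain p ε s))) ∧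
    ∃ φ : SteenrodFractal.Qeps p ε →ₐ[ZMod p] SteenrodFractal.Qeps p ε,
      Function.Injective φ ∧
      (∀ k : ℤ, φ (SteenrodFractal.zeps p ε k) =
        SteenrodFractal.zeps p ε (SteenrodFractal.shift p ε k)) ∧
      ∀ s : ℕ,
        (φ ^ s).range.map (SteenrodFractal.Qeps p ε).val = SteenrodFractal.Qchain p ε s ∧
        ∃ e : SteenrodFractal.Qeps p ε ≃ₐ[ZMod p] SteenrodFractal.Qchain p ε s,
          (∀ x, ((e x : SteenrodFractal.Qchain p ε s) : SteenrodFractal.Q p) =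
            (((φ ^ s) x : SteenrodFractal.Qeps p ε) : SteenrodFractal.Q p)) ∧
          ∀ m : ℕ,
            (SteenrodFractal.subLengthPart (SteenrodFractal.Qeps p ε) m).map
                e.toLinearEquiv.toLinearMap =
              SteenrodFractal.subLengthPart (SteenrodFractal.Qchain p ε s) m := by
  let φ : Qeps p ε →ₐ[ZMod p] Qeps p ε :=
    ((frob p ε).comp (Qeps p ε).val).codRestrict (Qeps p ε) fun x => frob_mem_Qeps x.2
  have hφ : ∀ (s : ℕ) (x : Qeps p ε), (((φ ^ s) x : Qeps p ε) : Q p) = (frob p ε ^ s) x := by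
    intro s
    induction s with
    | zero => exact fun x => rfl
    | succ s ih =>
      intro x
      rw [pow_succ, pow_succ, AlgHom.mul_apply, AlgHom.mul_apply, ih]
      rfl
  refine ⟨?_, Qchain_succ_lt hp ε, fun s => isInternal_subLengthPart_adjoin ?_, φ, ?_, ?_, ?_⟩
  · rw [Qchain_eq_map, pow_zero]
    exact Subalgebra.map_id _
  · rintro _ ⟨m, rfl⟩
    exact ⟨ε, _, rfl⟩
  · exact fun x y h => Subtype.ext (injOn_frob ε x.2 y.2 (congrArg Subtype.val h))
  · exact fun k => Subtype.ext ((frob_z_self ε k).trans (by rw [← shift_eq]; rfl))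
  · intro s
    refine ⟨?_, ?_⟩
    · rw [Qchain_eq_map]
      ext y
      constructor
      · rintro ⟨_, ⟨x, rfl⟩, rfl⟩
        exact ⟨x, x.2, (hφ s x).symm⟩
      · rintro ⟨x, hx, rfl⟩
        exact ⟨_, ⟨⟨x, hx⟩, rfl⟩, hφ s ⟨x, hx⟩⟩
    · let e₀ : Qeps p ε →ₐ[ZMod p] Qchain p ε s :=
        ((frob p ε ^ s).comp (Qeps p ε).val).codRestrict (Qchain p ε s) fun x => by
          rw [Qchain_eq_map]
          exact ⟨x, x.2, rfl⟩
      have he₀ : Function.Bijective e₀ := by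
        refine ⟨fun x y h => Subtype.ext (injOn_frob_pow ε s x.2 y.2 (congrArg Subtype.val h)),
          fun y => ?_⟩
        obtain ⟨x, hx, hxy⟩ := (Qchain_eq_map ε s).le y.2
        exact ⟨⟨x, hx⟩, Subtype.ext hxy⟩
      refine ⟨AlgEquiv.ofBijective e₀ he₀, fun x => (hφ s x).symm, fun m => ?_⟩
      ext y
      constructor
      · rintro ⟨x, hx, rfl⟩
        exact (frob_pow_mem_lengthPart_iff ε s m x.2).2 hx
      · intro hy
        obtain ⟨x, rfl⟩ := he₀.2 y
        exact ⟨x, (frob_pow_mem_lengthPart_iff ε s m x.2).1 hy, rfl⟩
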